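/- Let $K$ be a field with algebraic closure $\bar K$, let $A=\{a_1,\dots,a_{N_A}\}$ be parameters and $X=\{x_1,\dots,x_{N_X}\}$ indeterminates, and let $\tau$ be a term-ordering on the power-products of $R=K[A,X]$ which is an elimination ordering for $X$ in the following sense: power-products are compared by their $X$-parts first, i.e. $s<_\tau t$ implies $su<_\tau tv$ for power-products $s,t$ in $X$ and $u,v$ in $A$. Let $\tau_X$ be the restriction of $\tau$ to the power-products in $X$. For nonzero $f\in R$ let $\mathrm{LPP}(f)$ be its $\tau$-leading power-product, $\mathrm{LPP}_X(f)$ the $\tau_X$-leading power-product of $f$ as a polynomial in $K[A][X]$, and $\mathrm{LC}_X(f)\in K[A]$ the corresponding coefficient. For $F\subseteq R$ let $\mathrm{MB}(F)$ be the minimal set of power-products that generates the monomial ideal $\langle \mathrm{LPP}_X(f)\mid f\in F\setminus\{0\}\rangle$ of $K[X]$. For an ideal $\mathfrak a$ of $K[A]$ let $\mathbb V(\mathfrak a)\subseteq\bar K^{N_A}$ be its set of zeros. For $P\in\bar K^{N_A}$ let $\sigma_P:K[A,X]\to\bar K[X]$, $f\mapsto f(P,X)$, and for an ideal $I$ of $R$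 let $\sigma_P(I)$ denote the ideal of $\bar K[X]$ generated by the image of $I$. A Gröbner basis of an ideal is a finite subset of it such that the leading power-product of each nonzero element of the ideal is divisible by that of some nonzero element of the subset; it is minimal if it does not contain $0$ and no leading power-product of one of its elements divides that of another. Consider the following algorithm CGS-Iter, whose input is an ideal $I$ of $R$. It maintains a set $T$ of ideals of $K[A]$, initially $T=\{\langle0\rangle\}$, and a set $\mathcal F$ of pairs, initially empty. While $T\neq\emptyset$: 1. Choose an ideal $\mathfrak a\in T$ and remove it from $T$. Let $J=I+\mathfrak aR$, compute a $\tau$-Gröbner basis $G$ of $J$, and let $\mathfrak g=J\cap K[A]$. 2. If $\mathbb V(\mathfrak a)\setminus\mathbb V(\mathfrak g)\ne\emptyset$, append $(\mathbb V(\mathfrak a)\setminus\mathbb V(\mathfrak g),\{1\})$ to $\mathcal F$, and append $\mathfrak g$ to $T$ if $\mathfrak g$ contains no ideal in $T$. 3. Otherwise let $M=\mathrm{MB}(G\setminus\mathfrak g)$, and for $t\in M$ let $\mathfrak c_t=\langle \mathrm{LC}_X(g)\mid g\in G,\ \mathrm{LPP}_X(g)=t\rangle$. Append $\bigl(\mathbb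 V(\mathfrak g)\setminus\bigcup_{t\in M}\mathbb V(\mathfrak c_t),\ \{g\in G\mid \mathrm{LPP}_X(g)\in M\}\bigr)$ to $\mathcal F$. For each inclusion-minimal element $\mathfrak b$ of $\{\mathfrak c_t+\mathfrak g\mid t\in M,\ \mathfrak c_t\not\subseteq\mathfrak g\}$, append $\mathfrak b$ to $T$ if $\mathfrak b$ contains no ideal in $T$. The output is $\mathcal F$. Theorem. Let $I$ be any ideal of $R$. (1) The algorithm with input $I$ terminates, whatever ideals $\mathfrak a$ and Gröbner bases $G$ are chosen, and also if $G$ is required to be minimal. (2) For each pair $(\mathcal A,G)$ in its output and each point $P\in\mathcal A$, $\sigma_P(G)$ is a $\tau_X$-Gröbner basis of $\sigma_P(I)$. (3) If the Gröbner bases computed in step 1 are minimal (for example, reduced), then each point $P\in\bar K^{N_A}$ lies in at least one set $\mathcal A$ with $(\mathcal A,G)$ in the output. In summary, if the Gröbner bases computed in step 1 are minimal, the output is a comprehensive Gröbner system for $I$: a finite set of pairs $(\mathcal A,G)$ such that each $\mathcal A$ is of the form $\mathbb V(\mathfrak a)\setminus\mathbb V(\mathfrak b)$ with ideals $\mathfrak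 a,\mathfrak b$ of $K[A]$, the sets $\mathcal A$ cover $\bar K^{N_A}$, each $G$ is a finite subset of $R$, and $\sigma_P(G)$ is a $\tau_X$-Gröbner basis of $\sigma_P(I)$ for each pair and each $P\in\mathcal A$. -/

import Mathlib

/-! Polynomials in the parameters `A` and the indeterminates `X` are elements of
`MvPolynomial (X ⊕ A) K`; an indeterminate is `Sum.inl x`, a parameter is `Sum.inr a`.
A power-product is identified with its exponent vector. A term-ordering on the
power-products is a `MonomialOrder`. -/

open MvPolynomial
open scoped MonomialOrder

namespace CGS

noncomputable section

/-! ### Gröbner bases over a field -/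

section Groebner

variable {σ k : Type*} [Field k]

/-- `G` is an `m`-Gröbner basis of the ideal `I`: a finite subset of `I` such that the leading
power-product of every nonzero element of `I` is divisible by the leading power-product of some
nonzero element of `G`. (The zero polynomial is allowed in `G`, where it plays no role.) -/
def IsGroebnerBasis (m : MonomialOrder σ) (I : Ideal (MvPolynomial σ k))
    (G : Set (MvPolynomial σ k)) : Prop :=
  G.Finite ∧ G ⊆ I ∧ ∀ f ∈ I, f ≠ 0 → ∃ g ∈ G, g ≠ 0 ∧ m.degree g ≤ m.degree f

/-- A minimal Gröbner basis: a Gröbner basis of nonzero polynomials in which no leading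
power-product is divisible by the leading power-product of another element. -/
def IsMinimalGroebnerBasis (m : MonomialOrder σ) (I : Ideal (MvPolynomial σ k))
    (G : Set (MvPolynomial σ k)) : Prop :=
  IsGroebnerBasis m I G ∧ 0 ∉ G ∧
    ∀ g ∈ G, ∀ g' ∈ G, g' ≠ g → ¬ m.degree g' ≤ m.degree g

end Groebner

variable {K A X : Type*} [Field K]

/-! ### Elimination orderings and the induced ordering on the power-products in `X` -/

/-- `τ` is an elimination ordering for `X`: power-products in `K[A,X]` are compared by their
`X`-parts first, i.e. `s < t` implies `s * u < t * v` for power-products `s`, `t` in `X` and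
`u`, `v` in `A`. For `s = 1` this says that every power-product only in `A` is smaller than every
power-product that contains an indeterminate in `X`. -/
def IsEliminationOrder (τ : MonomialOrder (X ⊕ A)) : Prop :=
  ∀ (s t : X →₀ ℕ) (u v : A →₀ ℕ),
    (s.mapDomain Sum.inl ≺[τ] t.mapDomain Sum.inl) →
      (s.mapDomain Sum.inl + u.mapDomain Sum.inr ≺[τ] t.mapDomain Sum.inl + v.mapDomain Sum.inr)

/-- The map underlying the restriction of `τ` to the power-products only in `X`. -/
def restrictXHom (τ : MonomialOrder (X ⊕ A)) : (X →₀ ℕ) →+ τ.syn :=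
  (τ.toSyn : (X ⊕ A →₀ ℕ) →+ τ.syn).comp (Finsupp.mapDomain.addMonoidHom Sum.inl)

theorem restrictXHom_injective (τ : MonomialOrder (X ⊕ A)) :
    Function.Injective (restrictXHom τ) := fun _ _ h =>
  Finsupp.mapDomain_injective Sum.inl_injective (τ.toSyn.injective h)

/-- `τ_X`, the restriction of `τ` to the power-products only in `X`. -/
def restrictX (τ : MonomialOrder (X ⊕ A)) : MonomialOrder X where
  syn := AddMonoidHom.mrange (restrictXHom τ)
  addCommMonoidSyn := AddSubmonoid.toAddCommMonoid _
  linearOrderSyn := Subtype.instLinearOrder _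
  isOrderedAddMonoid_syn := AddSubmonoid.toIsOrderedAddMonoid _
  toSyn :=
    { Equiv.ofBijective (restrictXHom τ).mrangeRestrict
        ⟨fun _ _ h => restrictXHom_injective τ (congrArg Subtype.val h),
          (restrictXHom τ).mrangeRestrict_surjective⟩ with
      map_add' := fun s t => Subtype.ext (map_add (restrictXHom τ) s t) }
  toSyn_monotone := by
    intro s t h
    obtain ⟨u, rfl⟩ := exists_add_of_le h
    change restrictXHom τ s ≤ restrictXHom τ (s + u)
    rw [map_add]
    exact le_add_of_nonneg_right (τ.zero_le _)

theorem restrictX_le_iff (τ : MonomialOrder (X ⊕ A)) (s t : X →₀ ℕ) :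
    (s ≼[restrictX τ] t) ↔ (s.mapDomain Sum.inl ≼[τ] t.mapDomain Sum.inl) := Iff.rfl

/-- `LPP_X(f)`: the `τ_X`-greatest power-product of `f` as a polynomial in `K[A][X]`. -/
def lppX (τ : MonomialOrder (X ⊕ A)) (f : MvPolynomial (X ⊕ A) K) : X →₀ ℕ :=
  (restrictX τ).degree (sumAlgEquiv K X A f)

/-- `LC_X(f)`: the coefficient in `K[A]` of `LPP_X(f)` in `f`. -/
def lcX (τ : MonomialOrder (X ⊕ A)) (f : MvPolynomial (X ⊕ A) K) : MvPolynomial A K :=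
  (restrictX τ).leadingCoeff (sumAlgEquiv K X A f)

/-- `MB(F)`: the minimal basis of the monomial ideal `⟨LPP_X(f) ∣ f ∈ F⟩` of `K[X]`, i.e. the
minimal elements with respect to divisibility among the power-products `LPP_X(f)`, `f ∈ F`,
`f ≠ 0`. -/
def minimalBasis (τ : MonomialOrder (X ⊕ A)) (F : Set (MvPolynomial (X ⊕ A) K)) :
    Set (X →₀ ℕ) :=
  {t | Minimal (fun s => ∃ f ∈ F, f ≠ 0 ∧ lppX τ f = s) t}

/-! ### Specialization -/

/-- `σ_P : K[A,X] → K̄[X]`, `f ↦ f(P, X)`. -/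
def specialize (X : Type*) (P : A → AlgebraicClosure K) :
    MvPolynomial (X ⊕ A) K →ₐ[K] MvPolynomial X (AlgebraicClosure K) :=
  aeval (Sum.elim MvPolynomial.X fun a => C (P a))

/-- The set of zeros in the affine space over `K̄` of an ideal of `K[A]`. -/
def zeros (𝔞 : Ideal (MvPolynomial A K)) : Set (A → AlgebraicClosure K) :=
  zeroLocus (AlgebraicClosure K) 𝔞

/-- The condition that the specialization of `G` is a `τ_X`-Gröbner basis of the ideal `σ_P(I)`
of `K̄[X]` (generated by the image of `I`) for every point `P` of the set `𝒜`. -/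
def IsGroebnerSegment (τ : MonomialOrder (X ⊕ A)) (I : Ideal (MvPolynomial (X ⊕ A) K))
    (𝒜 : Set (A → AlgebraicClosure K)) (G : Set (MvPolynomial (X ⊕ A) K)) : Prop :=
  ∀ P ∈ 𝒜, IsGroebnerBasis (restrictX τ) (I.map (specialize X P)) (specialize X P '' G)

/-- A finite set of pairs `(𝒜, G)` is a comprehensive Gröbner system for `I`: the `𝒜`s are sets
of the form `V(𝔞) \ V(𝔟)` which cover the parameter space over `K̄`, the `G`s are finite, and
`σ_P(G)` is a `τ_X`-Gröbner basis of `σ_P(I)` for each pair `(𝒜, G)` and each `P ∈ 𝒜`. -/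
def IsComprehensiveGroebnerSystem (τ : MonomialOrder (X ⊕ A))
    (I : Ideal (MvPolynomial (X ⊕ A) K))
    (𝒢 : Set (Set (A → AlgebraicClosure K) × Set (MvPolynomial (X ⊕ A) K))) : Prop :=
  𝒢.Finite ∧
  (∀ p ∈ 𝒢, ∃ 𝔞 𝔟 : Ideal (MvPolynomial A K), p.1 = zeros 𝔞 \ zeros 𝔟) ∧
  (⋃ p ∈ 𝒢, p.1) = Set.univ ∧
  (∀ p ∈ 𝒢, p.2.Finite) ∧
  ∀ p ∈ 𝒢, IsGroebnerSegment τ I p.1 p.2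

/-! ### The algorithm -/

/-- The extension to `K[A,X]` of an ideal of `K[A]`. -/
def extend (X : Type*) (𝔞 : Ideal (MvPolynomial A K)) : Ideal (MvPolynomial (X ⊕ A) K) :=
  𝔞.map (rename (Sum.inr : A → X ⊕ A))

/-- The ideal `J ∩ K[A]` of `K[A]`. -/
def eliminate (J : Ideal (MvPolynomial (X ⊕ A) K)) : Ideal (MvPolynomial A K) :=
  J.comap (rename (Sum.inr : A → X ⊕ A))

/-- The minimal basis `MB(G \ 𝔤)`. -/
def stepMB (τ : MonomialOrder (X ⊕ A)) (G : Set (MvPolynomial (X ⊕ A) K))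
    (𝔤 : Ideal (MvPolynomial A K)) : Set (X →₀ ℕ) :=
  minimalBasis τ (G \ (rename (Sum.inr : A → X ⊕ A) '' (𝔤 : Set (MvPolynomial A K))))

/-- The ideal `𝔠_t = ⟨LC_X(g) ∣ g ∈ G, LPP_X(g) = t⟩` of `K[A]`. -/
def lcIdeal (τ : MonomialOrder (X ⊕ A)) (G : Set (MvPolynomial (X ⊕ A) K)) (t : X →₀ ℕ) :
    Ideal (MvPolynomial A K) :=
  Ideal.span (lcX τ '' {g ∈ G | lppX τ g = t})

/-- The inclusion-minimal elements of a set of ideals. -/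
def minimalized (S : Set (Ideal (MvPolynomial A K))) : Set (Ideal (MvPolynomial A K)) :=
  {𝔟 | Minimal (· ∈ S) 𝔟}

/-- The set `NewVanishing`. -/
def newVanishing (τ : MonomialOrder (X ⊕ A)) (G : Set (MvPolynomial (X ⊕ A) K))
    (𝔤 : Ideal (MvPolynomial A K)) : Set (Ideal (MvPolynomial A K)) :=
  minimalized {𝔟 | ∃ t ∈ stepMB τ G 𝔤, ¬ lcIdeal τ G t ≤ 𝔤 ∧ 𝔟 = lcIdeal τ G t ⊔ 𝔤}

/-- The result of appending to `T` those elements of `N` which contain no ideal in `T`.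
The elements of `N` are pairwise incomparable wherever this is used, so that the order in which
they are tried does not matter. -/
def appendMinimal (T N : Set (Ideal (MvPolynomial A K))) : Set (Ideal (MvPolynomial A K)) :=
  T ∪ {𝔟 ∈ N | ∀ 𝔷 ∈ T, ¬ 𝔷 ≤ 𝔟}

/-- The two variables of the algorithm. -/
structure State (K A X : Type*) [Field K] where
  /-- `VanishingToDo`, a set of ideals of `K[A]` -/
  todo : Set (Ideal (MvPolynomial A K))
  /-- `FinalCases`, a set of pairs `(𝒜, G)` -/
  final : Set (Set (A → AlgebraicClosure K) × Set (MvPolynomial (X ⊕ A) K))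

/-- Initialization: `VanishingToDo = {⟨0⟩}`, `FinalCases = ∅`. -/
def State.init (K A X : Type*) [Field K] : State K A X where
  todo := {⊥}
  final := ∅

/-- One iteration of the main loop, for the input `I`. The ideal `𝔞` chosen in `VanishingToDo` and
the Gröbner basis `G` of `I + 𝔞` are arbitrary; `gb J G` says that `G` may be returned
by the subroutine which computes a Gröbner basis of `J`. -/
inductive Step (τ : MonomialOrder (X ⊕ A)) (I : Ideal (MvPolynomial (X ⊕ A) K))
    (gb : Ideal (MvPolynomial (X ⊕ A) K) → Set (MvPolynomial (X ⊕ A) K) → Prop) :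
    State K A X → State K A X → Prop
  | smaller (S : State K A X) (𝔞 𝔤 : Ideal (MvPolynomial A K))
      (G : Set (MvPolynomial (X ⊕ A) K))
      (h𝔞 : 𝔞 ∈ S.todo) (hG : gb (I ⊔ extend X 𝔞) G) (h𝔤 : 𝔤 = eliminate (I ⊔ extend X 𝔞))
      (hne : (zeros 𝔞 \ zeros 𝔤).Nonempty) :
      Step τ I gb S
        { todo := appendMinimal (S.todo \ {𝔞}) {𝔤}
          final := insert (zeros 𝔞 \ zeros 𝔤, {1}) S.final }
  | equal (S : State K A X) (𝔞 𝔤 : Ideal (MvPolynomial A K))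
      (G : Set (MvPolynomial (X ⊕ A) K))
      (h𝔞 : 𝔞 ∈ S.todo) (hG : gb (I ⊔ extend X 𝔞) G) (h𝔤 : 𝔤 = eliminate (I ⊔ extend X 𝔞))
      (hne : ¬ (zeros 𝔞 \ zeros 𝔤).Nonempty) :
      Step τ I gb S
        { todo := appendMinimal (S.todo \ {𝔞}) (newVanishing τ G 𝔤)
          final := insert
            (zeros 𝔤 \ ⋃ t ∈ stepMB τ G 𝔤, zeros (lcIdeal τ G t),
              {g ∈ G | lppX τ g ∈ stepMB τ G 𝔤}) S.final }

/-- The states which can occur between two iterations in a computation with input `I`. -/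
def Reachable (τ : MonomialOrder (X ⊕ A)) (I : Ideal (MvPolynomial (X ⊕ A) K))
    (gb : Ideal (MvPolynomial (X ⊕ A) K) → Set (MvPolynomial (X ⊕ A) K) → Prop)
    (S : State K A X) : Prop :=
  Relation.ReflTransGen (Step τ I gb) (State.init K A X) S

/-- The algorithm terminates with input `I`, whatever choices are made: the main loop cannot be
iterated forever, and it never gets stuck before `VanishingToDo` is empty. -/
def Terminates (τ : MonomialOrder (X ⊕ A)) (I : Ideal (MvPolynomial (X ⊕ A) K))
    (gb : Ideal (MvPolynomial (X ⊕ A) K) → Set (MvPolynomial (X ⊕ A) K) → Prop) : Prop :=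
  (¬ ∃ run : ℕ → State K A X,
    run 0 = State.init K A X ∧ ∀ n, Step τ I gb (run n) (run (n + 1))) ∧
  ∀ S : State K A X, Reachable τ I gb S → S.todo.Nonempty → ∃ S', Step τ I gb S S'

/-- `𝒢` is an output of the algorithm with input `I`: the value of `FinalCases` when
`VanishingToDo` has become empty. -/
def IsOutput (τ : MonomialOrder (X ⊕ A)) (I : Ideal (MvPolynomial (X ⊕ A) K))
    (gb : Ideal (MvPolynomial (X ⊕ A) K) → Set (MvPolynomial (X ⊕ A) K) → Prop)
    (𝒢 : Set (Set (A → AlgebraicClosure K) × Set (MvPolynomial (X ⊕ A) K))) : Prop :=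
  Reachable τ I gb { todo := ∅, final := 𝒢 }

end

end CGS

/-! Correctness rests on the stability theorem `isGroebnerBasis_specialize`. Let P be a zero of 𝔤 =
J ∩ K[A] at which no 𝔠_t vanishes identically. For each power-product s divisible by some t ∈ M,
some element of G has `LPP_X` dividing s and a leading coefficient that survives at P, so its
specialization has a multiple with leading power-product exactly s. These multiples span σ_P(J) over
K̄: an f ∈ J is reduced by induction on its τ-leading power-product. If the element of G dividing it
lies in 𝔤, it specializes to 0 and its leading term can be cancelled at no cost; otherwise
`LPP_X(f)` is divisible by some t ∈ M and the cancellation is done over K[A] with a chosen multiple.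
Since P is a zero of 𝔞, σ_P(J) = σ_P(I).

Termination: every iteration replaces 𝔞 by finitely many strictly larger ideals of the noetherian
ring K[A]. This is a move of the hydra game on multisets, hence well-founded
(`cutExpand_appendMinimal`).

Covering is a loop invariant (`Reachable.exists_mem`): a point is already in a segment or is a zero
of a pending ideal. Points of V(𝔠_t) ∩ V(𝔤) could only be lost if 𝔠_t ⊆ 𝔤, and minimality of G
excludes this (`not_lcIdeal_le_eliminate`). -/

namespace CGS

/-! ### Leading power-products and Gröbner bases over a field -/

section Groebner

variable {σ : Type*}

/-- Cancelling the leading term of `f` by a multiple of `g` lowers the degree. -/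
theorem degree_cancel_lt {R : Type*} [CommRing R] (m : MonomialOrder σ) {f g : MvPolynomial σ R}
    (hgf : m.degree g ≤ m.degree f)
    (hne : C (m.leadingCoeff g) * f -
      monomial (m.degree f - m.degree g) (m.leadingCoeff f) * g ≠ 0) :
    m.degree (C (m.leadingCoeff g) * f -
      monomial (m.degree f - m.degree g) (m.leadingCoeff f) * g) ≺[m] m.degree f := by
  classical
  set h := C (m.leadingCoeff g) * f -
      monomial (m.degree f - m.degree g) (m.leadingCoeff f) * g with hh
  have h1 : m.degree h ≼[m] m.degree f := by
    refine m.degree_sub_le.trans (sup_le ?_ ?_)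
    · refine m.degree_mul_le.trans ?_
      simp
    · refine m.degree_mul_le.trans ?_
      calc m.toSyn (m.degree (monomial (m.degree f - m.degree g) (m.leadingCoeff f)) + m.degree g)
          ≤ m.toSyn ((m.degree f - m.degree g) + m.degree g) := by
            rw [map_add, map_add]
            gcongr
            exact m.degree_monomial_le _
        _ = m.toSyn (m.degree f) := by rw [tsub_add_cancel_of_le hgf]
  refine lt_of_le_of_ne h1 fun heq => ?_
  have heq' := m.toSyn.injective heq
  apply hne
  rw [← m.coeff_degree_eq_zero_iff, heq', hh, coeff_sub, coeff_C_mul, coeff_monomial_mul',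
    if_pos tsub_le_self, tsub_tsub_cancel_of_le hgf]
  simp only [MonomialOrder.leadingCoeff]
  ring

/-- The leading power-products of the family are pairwise distinct, so in a linear combination the
greatest one with nonzero coefficient cannot cancel. -/
theorem degree_mem_of_mem_span {k : Type*} [Field k] (m : MonomialOrder σ)
    {S : Set (σ →₀ ℕ)} {b : (σ →₀ ℕ) → MvPolynomial σ k}
    (hb : ∀ s ∈ S, b s ≠ 0 ∧ m.degree (b s) = s) {h : MvPolynomial σ k}
    (hh : h ∈ Submodule.span k (b '' S)) (h0 : h ≠ 0) : m.degree h ∈ S := by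
  classical
  obtain ⟨l, hl, rfl⟩ := (Finsupp.mem_span_image_iff_linearCombination k).1 hh
  have hlS : ∀ s ∈ l.support, s ∈ S := fun s hs => (Finsupp.mem_supported k l).1 hl hs
  have hne : l.support.Nonempty := by
    rw [Finsupp.support_nonempty_iff]
    rintro rfl
    simp at h0
  obtain ⟨s, hs, hmax⟩ := l.support.exists_max_image m.toSyn hne
  have hc : coeff s (Finsupp.linearCombination k b l) ≠ 0 := by
    rw [Finsupp.linearCombination_apply, Finsupp.sum, coeff_sum,
      Finset.sum_eq_single_of_mem s hs]
    · rw [coeff_smul, smul_eq_mul]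
      refine mul_ne_zero (Finsupp.mem_support_iff.1 hs) ?_
      have := m.coeff_degree_ne_zero_iff.2 (hb s (hlS s hs)).1
      rwa [(hb s (hlS s hs)).2] at this
    · intro t ht hts
      rw [coeff_smul, m.coeff_eq_zero_of_lt, smul_zero]
      rw [(hb t (hlS t ht)).2]
      exact lt_of_le_of_ne (hmax t ht) fun h => hts (m.toSyn.injective h)
  have hle : m.degree (Finsupp.linearCombination k b l) ≼[m] s := by
    rw [Finsupp.linearCombination_apply, Finsupp.sum]
    refine m.degree_sum_le.trans (Finset.sup_le fun t ht => ?_)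
    refine m.degree_smul_le.trans ?_
    rw [(hb t (hlS t ht)).2]
    exact hmax t ht
  have : m.degree (Finsupp.linearCombination k b l) = s :=
    m.toSyn.injective (le_antisymm hle (m.le_degree (mem_support_iff.2 hc)))
  rw [this]
  exact hlS s hs

/-- Every ideal has a minimal Gröbner basis. -/
theorem exists_isMinimalGroebnerBasis {k : Type*} [Field k] [Finite σ] (m : MonomialOrder σ)
    (I : Ideal (MvPolynomial σ k)) : ∃ G, IsMinimalGroebnerBasis m I G := by
  let D : Set (σ →₀ ℕ) := {d | ∃ f ∈ I, f ≠ 0 ∧ m.degree f = d}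
  let M : Set (σ →₀ ℕ) := {d | Minimal (· ∈ D) d}
  -- Dickson's lemma: divisibility of power-products in finitely many variables is a
  -- well-quasi-order.
  have hM : M.Finite :=
    WellQuasiOrderedLE.finite_of_isAntichain (setOfPred_minimal_antichain _)
  have hD : ∀ d : M, ∃ f ∈ I, f ≠ 0 ∧ m.degree f = d := fun d => d.2.1
  choose e heI he0 hed using hD
  have := hM.to_subtype
  refine ⟨Set.range e, ⟨Set.finite_range e, ?_, ?_⟩, ?_, ?_⟩
  · rintro _ ⟨d, rfl⟩
    exact heI d
  · intro f hf hf0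
    obtain ⟨d, hdf, hd⟩ := exists_minimal_le_of_wellFoundedLT (· ∈ D) (m.degree f)
      ⟨f, hf, hf0, rfl⟩
    exact ⟨e ⟨d, hd⟩, ⟨_, rfl⟩, he0 _, (hed ⟨d, hd⟩).trans_le hdf⟩
  · rintro ⟨d, hd⟩
    exact he0 d hd
  · rintro _ ⟨d, rfl⟩ _ ⟨d', rfl⟩ hne hle
    rw [hed, hed] at hle
    exact hne (congrArg e (Subtype.ext (d.2.eq_of_le d'.2.1 hle)))

end Groebner

variable {K A X : Type*} [Field K]

/-! ### Leading terms in K[A,X] and in K[A][X] -/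

theorem coeff_coeff_sumAlgEquiv (f : MvPolynomial (X ⊕ A) K) (s : X →₀ ℕ) (u : A →₀ ℕ) :
    coeff u (coeff s (sumAlgEquiv K X A f)) =
      coeff (s.mapDomain Sum.inl + u.mapDomain Sum.inr) f := by
  rw [← Finsupp.sumElim_eq_add]
  simp [sumAlgEquiv, coeff, AddMonoidAlgebra.curryAlgEquiv, AddMonoidAlgebra.curryRingEquiv,
    AddMonoidAlgebra.curryAddEquiv]

theorem exists_eq_mapDomain_add (d : X ⊕ A →₀ ℕ) :
    ∃ (s : X →₀ ℕ) (u : A →₀ ℕ), d = s.mapDomain Sum.inl + u.mapDomain Sum.inr :=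
  ⟨_, _, by rw [← Finsupp.sumElim_eq_add, Finsupp.comapDomain_sumElim_comapDomain]⟩

theorem sumAlgEquiv_ne_zero {f : MvPolynomial (X ⊕ A) K} (hf : f ≠ 0) :
    sumAlgEquiv K X A f ≠ 0 := by simpa using hf

theorem lcX_ne_zero (τ : MonomialOrder (X ⊕ A)) {f : MvPolynomial (X ⊕ A) K} (hf : f ≠ 0) :
    lcX τ f ≠ 0 :=
  MonomialOrder.leadingCoeff_ne_zero_iff.2 (sumAlgEquiv_ne_zero hf)

theorem coeff_lcX (τ : MonomialOrder (X ⊕ A)) (f : MvPolynomial (X ⊕ A) K) (u : A →₀ ℕ) :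
    coeff u (lcX τ f) = coeff ((lppX τ f).mapDomain Sum.inl + u.mapDomain Sum.inr) f :=
  coeff_coeff_sumAlgEquiv f _ u

/-- The `X`-part of the leading power-product is `LPP_X`. -/
theorem exists_degree_eq {τ : MonomialOrder (X ⊕ A)} (hτ : IsEliminationOrder τ)
    {f : MvPolynomial (X ⊕ A) K} (hf : f ≠ 0) :
    ∃ u ∈ (lcX τ f).support,
      τ.degree f = (lppX τ f).mapDomain Sum.inl + u.mapDomain Sum.inr := by
  obtain ⟨s, u, hsu⟩ := exists_eq_mapDomain_add (τ.degree f)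
  have hc : coeff u (coeff s (sumAlgEquiv K X A f)) ≠ 0 := by
    rw [coeff_coeff_sumAlgEquiv, ← hsu]
    exact MonomialOrder.coeff_degree_ne_zero_iff.2 hf
  have hs : s ≼[restrictX τ] lppX τ f :=
    (restrictX τ).le_degree (mem_support_iff.2 fun h => hc (by rw [h, coeff_zero]))
  obtain rfl : s = lppX τ f := by
    -- If s were smaller than `LPP_X(f)`, any power-product v of `LC_X(f)` would yield a
    -- power-product of f above the leading one, because the X-parts decide.
    by_contra hne
    have hlt : s ≺[restrictX τ] lppX τ f :=
      lt_of_le_of_ne hs fun h => hne ((restrictX τ).toSyn.injective h)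
    obtain ⟨v, hv⟩ := MvPolynomial.ne_zero_iff.1 (lcX_ne_zero τ hf)
    rw [coeff_lcX] at hv
    have h1 := τ.le_degree (mem_support_iff.2 hv)
    rw [hsu] at h1
    exact (hτ s (lppX τ f) u v hlt).not_ge h1
  exact ⟨u, mem_support_iff.2 hc, hsu⟩

theorem mapDomain_add_le_iff {s t : X →₀ ℕ} {u v : A →₀ ℕ} :
    s.mapDomain Sum.inl + u.mapDomain Sum.inr ≤ t.mapDomain Sum.inl + v.mapDomain Sum.inr ↔
      s ≤ t ∧ u ≤ v := by
  rw [← Finsupp.sumElim_eq_add, ← Finsupp.sumElim_eq_add]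
  simp [Finsupp.le_def]

theorem lppX_le_of_degree_le {τ : MonomialOrder (X ⊕ A)} (hτ : IsEliminationOrder τ)
    {f g : MvPolynomial (X ⊕ A) K} (hf : f ≠ 0) (hg : g ≠ 0) (h : τ.degree g ≤ τ.degree f) :
    lppX τ g ≤ lppX τ f := by
  obtain ⟨u, -, hu⟩ := exists_degree_eq hτ hf
  obtain ⟨v, -, hv⟩ := exists_degree_eq hτ hg
  rw [hu, hv, mapDomain_add_le_iff] at h
  exact h.1

/-- Makes a cancellation carried out in K[A][X] count as progress in an induction along τ. -/
theorem degree_lt_of_lppX_lt {τ : MonomialOrder (X ⊕ A)} (hτ : IsEliminationOrder τ)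
    {f g : MvPolynomial (X ⊕ A) K} (hf : f ≠ 0) (hg : g ≠ 0)
    (h : lppX τ g ≺[restrictX τ] lppX τ f) : τ.degree g ≺[τ] τ.degree f := by
  obtain ⟨u, -, hu⟩ := exists_degree_eq hτ hf
  obtain ⟨v, -, hv⟩ := exists_degree_eq hτ hg
  rw [hu, hv]
  exact hτ _ _ _ _ h

theorem sumAlgEquiv_rename_inr (p : MvPolynomial A K) :
    sumAlgEquiv K X A (rename Sum.inr p) = C p :=
  DFunLike.congr_fun (sumAlgEquiv_comp_rename_inr K X A) p

theorem eq_rename_of_lppX_eq_zero (τ : MonomialOrder (X ⊕ A)) {f : MvPolynomial (X ⊕ A) K}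
    (h : lppX τ f = 0) : f = rename Sum.inr (lcX τ f) := by
  apply (sumAlgEquiv K X A).injective
  rw [sumAlgEquiv_rename_inr]
  exact (restrictX τ).eq_C_of_degree_eq_zero h

/-! ### Specialization of the parameters -/

theorem specialize_eq_map (P : A → AlgebraicClosure K) (f : MvPolynomial (X ⊕ A) K) :
    specialize X P f = map (aeval P : MvPolynomial A K →ₐ[K] _).toRingHom
      (sumAlgEquiv K X A f) := by
  induction f using MvPolynomial.induction_on with
  | C a => simp [specialize, MvPolynomial.algebraMap_apply]
  | add p q hp hq => rw [map_add, map_add, map_add, hp, hq]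
  | mul_X p i hp =>
    rw [map_mul, map_mul, map_mul, hp]
    congr 1
    cases i <;> simp [specialize]

theorem specialize_rename_inr (P : A → AlgebraicClosure K) (p : MvPolynomial A K) :
    specialize X P (rename Sum.inr p) = C (aeval P p) := by
  rw [specialize_eq_map, sumAlgEquiv_rename_inr, map_C]
  rfl

theorem specialize_rename_inl_monomial (P : A → AlgebraicClosure K) (s : X →₀ ℕ) :
    specialize X P (rename Sum.inl (monomial s 1)) = monomial s 1 := by
  rw [specialize, aeval_rename, aeval_monomial, map_one, one_mul, monomial_eq, C_1, one_mul]
  rfl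

theorem specialize_C (P : A → AlgebraicClosure K) (c : K) :
    specialize X P (C c) = C (algebraMap K (AlgebraicClosure K) c) :=
  (specialize X P).commutes c

theorem sumAlgEquiv_rename_inl_monomial (s : X →₀ ℕ) :
    sumAlgEquiv K X A (rename Sum.inl (monomial s 1)) = monomial s 1 := by
  have := DFunLike.congr_fun (sumAlgEquiv_comp_rename_inl K X A) (monomial s 1)
  exact this.trans (by simp)

/-- Specialization acts on the coefficients in K[A], so it can only shrink the support in X, and the
leading coefficient is assumed to survive. -/
theorem degree_specialize (τ : MonomialOrder (X ⊕ A)) {P : A → AlgebraicClosure K}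
    {f : MvPolynomial (X ⊕ A) K} (h : aeval P (lcX τ f) ≠ 0) :
    specialize X P f ≠ 0 ∧ (restrictX τ).degree (specialize X P f) = lppX τ f := by
  have hc : coeff (lppX τ f) (specialize X P f) ≠ 0 := by
    rw [specialize_eq_map, coeff_map]
    exact h
  refine ⟨fun h0 => hc (by rw [h0, coeff_zero]), (restrictX τ).toSyn.injective
    (le_antisymm ?_ ((restrictX τ).le_degree (mem_support_iff.2 hc)))⟩
  refine (restrictX τ).degree_le_iff.2 fun d hd => (restrictX τ).le_degree ?_
  rw [specialize_eq_map] at hd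
  exact support_map_subset _ _ hd


/-! ### Zero sets of ideals of K[A] -/

theorem mem_zeros {𝔞 : Ideal (MvPolynomial A K)} {P : A → AlgebraicClosure K} :
    P ∈ zeros 𝔞 ↔ ∀ p ∈ 𝔞, aeval P p = 0 := Iff.rfl

theorem zeros_anti {𝔞 𝔟 : Ideal (MvPolynomial A K)} (h : 𝔞 ≤ 𝔟) : zeros 𝔟 ⊆ zeros 𝔞 :=
  zeroLocus_anti_mono h

theorem mem_zeros_sup {𝔞 𝔟 : Ideal (MvPolynomial A K)} {P : A → AlgebraicClosure K} :
    P ∈ zeros (𝔞 ⊔ 𝔟) ↔ P ∈ zeros 𝔞 ∧ P ∈ zeros 𝔟 := by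
  refine ⟨fun h => ⟨zeros_anti le_sup_left h, zeros_anti le_sup_right h⟩, fun ⟨ha, hb⟩ p hp => ?_⟩
  obtain ⟨a, h1, b, h2, rfl⟩ := Submodule.mem_sup.1 hp
  rw [map_add, ha a h1, hb b h2, add_zero]

/-- The product of the ideals works, as K̄ has no zero divisors. This gives the segments of the
algorithm the form V(𝔞) \ V(𝔟). -/
theorem exists_zeros_eq_biUnion {ι : Type*} {s : Set ι} (hs : s.Finite)
    (f : ι → Ideal (MvPolynomial A K)) : ∃ 𝔟, ⋃ i ∈ s, zeros (f i) = zeros 𝔟 := by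
  induction s, hs using Set.Finite.induction_on with
  | empty => exact ⟨⊤, by simp [zeros, zeroLocus_top]⟩
  | @insert i _ _ _ ih =>
    obtain ⟨𝔟, h𝔟⟩ := ih
    refine ⟨f i * 𝔟, ?_⟩
    rw [Set.biUnion_insert, h𝔟]
    refine Set.Subset.antisymm (Set.union_subset (zeros_anti Ideal.mul_le_left)
      (zeros_anti Ideal.mul_le_right)) fun P hP => ?_
    by_contra hnot
    rw [Set.mem_union, not_or, mem_zeros, mem_zeros] at hnot
    push Not at hnot
    obtain ⟨⟨p, hp, hp0⟩, q, hq, hq0⟩ := hnot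
    refine mul_ne_zero hp0 hq0 ?_
    rw [← map_mul]
    exact hP _ (Ideal.mul_mem_mul hp hq)

theorem le_eliminate (I : Ideal (MvPolynomial (X ⊕ A) K)) (𝔞 : Ideal (MvPolynomial A K)) :
    𝔞 ≤ eliminate (I ⊔ extend X 𝔞) := fun _ hp =>
  Ideal.mem_comap.2 (Ideal.mem_sup_right (Ideal.mem_map_of_mem _ hp))

/-- The elements of 𝔞 specialize to 0 at P, so what is proved for J = I + 𝔞R transfers to I. -/
theorem map_specialize_sup_extend (I : Ideal (MvPolynomial (X ⊕ A) K))
    {𝔞 : Ideal (MvPolynomial A K)} {P : A → AlgebraicClosure K} (hP : P ∈ zeros 𝔞) :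
    (I ⊔ extend X 𝔞).map (specialize X P) = I.map (specialize X P) := by
  rw [Ideal.map_sup, sup_eq_left]
  refine le_trans (le_of_eq ?_) bot_le
  rw [Ideal.map_eq_bot_iff_le_ker, extend, Ideal.map_le_iff_le_comap]
  intro p hp
  rw [Ideal.mem_comap, RingHom.mem_ker, specialize_rename_inr, hP p hp, C_0]

/-! ### Stability of Gröbner bases under specialization -/

theorem lppX_ne_zero_of_notMem {τ : MonomialOrder (X ⊕ A)} {J : Ideal (MvPolynomial (X ⊕ A) K)}
    {g : MvPolynomial (X ⊕ A) K} (hgJ : g ∈ J)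
    (hg : g ∉ rename (Sum.inr : A → X ⊕ A) '' (eliminate J : Set (MvPolynomial A K))) :
    lppX τ g ≠ 0 := fun h => by
  have := eq_rename_of_lppX_eq_zero τ h
  exact hg ⟨lcX τ g, Ideal.mem_comap.2 (this ▸ hgJ), this.symm⟩

theorem exists_of_notMem_zeros_lcIdeal {τ : MonomialOrder (X ⊕ A)}
    {G : Set (MvPolynomial (X ⊕ A) K)} {t : X →₀ ℕ} {P : A → AlgebraicClosure K}
    (h : P ∉ zeros (lcIdeal τ G t)) : ∃ g ∈ G, lppX τ g = t ∧ aeval P (lcX τ g) ≠ 0 := by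
  rw [zeros, lcIdeal, zeroLocus_span] at h
  simp only [Set.mem_ofPred_eq, Set.mem_image, not_forall] at h
  obtain ⟨_, ⟨g, hg, rfl⟩, h0⟩ := h
  exact ⟨g, hg.1, hg.2, h0⟩

/-- The stability theorem of Kapur, Sun and Wang: away from the zeros of the ideals `𝔠_t` a Gröbner
basis of `J` specializes to a Gröbner basis. -/
theorem isGroebnerBasis_specialize [Finite X] {τ : MonomialOrder (X ⊕ A)}
    (hτ : IsEliminationOrder τ) {J : Ideal (MvPolynomial (X ⊕ A) K)}
    {G : Set (MvPolynomial (X ⊕ A) K)} (hG : IsGroebnerBasis τ J G)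
    {P : A → AlgebraicClosure K} (hP : P ∈ zeros (eliminate J))
    (hc : ∀ t ∈ stepMB τ G (eliminate J), P ∉ zeros (lcIdeal τ G t)) :
    IsGroebnerBasis (restrictX τ) (J.map (specialize X P))
      (specialize X P '' {g ∈ G | lppX τ g ∈ stepMB τ G (eliminate J)}) := by
  obtain ⟨hGfin, hGJ, hGdvd⟩ := hG
  set M := stepMB τ G (eliminate J) with hM
  let S : Set (X →₀ ℕ) := {s | ∃ t ∈ M, t ≤ s}
  -- The divisor is chosen by a total function of s; outside S its value is arbitrary (0 here).
  have hex : ∀ s, ∃ g, s ∈ S →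
      g ∈ G ∧ lppX τ g ∈ M ∧ lppX τ g ≤ s ∧ aeval P (lcX τ g) ≠ 0 := by
    intro s
    by_cases hs : s ∈ S
    · obtain ⟨t, ht, hts⟩ := hs
      obtain ⟨g, hg, rfl, hg0⟩ := exists_of_notMem_zeros_lcIdeal (hc t ht)
      exact ⟨g, fun _ => ⟨hg, ht, hts, hg0⟩⟩
    · exact ⟨0, fun h => (hs h).elim⟩
  choose e he using hex
  let b : (X →₀ ℕ) → MvPolynomial X (AlgebraicClosure K) := fun s =>
    monomial (s - lppX τ (e s)) 1 * specialize X P (e s)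
  have hb : ∀ s ∈ S, b s ≠ 0 ∧ (restrictX τ).degree (b s) = s := by
    classical
    intro s hs
    obtain ⟨-, -, hle, h0⟩ := he s hs
    obtain ⟨h1, h2⟩ := degree_specialize τ h0
    have hm : (monomial (s - lppX τ (e s)) 1 : MvPolynomial X (AlgebraicClosure K)) ≠ 0 := by
      simp
    refine ⟨mul_ne_zero hm h1, ?_⟩
    rw [MonomialOrder.degree_mul hm h1, h2, MonomialOrder.degree_monomial, if_neg one_ne_zero,
      tsub_add_cancel_of_le hle]
  let W := Submodule.span (AlgebraicClosure K) (b '' S)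
  have key : ∀ f ∈ J, specialize X P f ∈ W := by
    intro f
    induction hd : τ.toSyn (τ.degree f) using WellFoundedLT.induction generalizing f with
    | _ d ih =>
    intro hf
    by_cases hf0 : f = 0
    · rw [hf0, map_zero]
      exact W.zero_mem
    obtain ⟨g, hgG, hg0, hgf⟩ := hGdvd f hf hf0
    by_cases hgg : g ∈ rename (Sum.inr : A → X ⊕ A) '' (eliminate J : Set (MvPolynomial A K))
    · obtain ⟨p, hp, rfl⟩ := hgg
      -- Here g specializes to 0, so cancelling the leading term of f only scales σ_P(f) by a
      -- nonzero constant.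
      set g := rename (Sum.inr : A → X ⊕ A) p with hg
      set f' := C (τ.leadingCoeff g) * f -
        monomial (τ.degree f - τ.degree g) (τ.leadingCoeff f) * g with hf'
      have hf'J : f' ∈ J := J.sub_mem (J.mul_mem_left _ hf) (J.mul_mem_left _ (hGJ hgG))
      have hσ : specialize X P f' =
          algebraMap K (AlgebraicClosure K) (τ.leadingCoeff g) • specialize X P f := by
        have : specialize X P g = 0 := by rw [hg, specialize_rename_inr, hP p hp, C_0]
        rw [hf', map_sub, map_mul, map_mul, this, mul_zero, sub_zero, specialize_C,
          MvPolynomial.C_mul']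
      have hW : specialize X P f' ∈ W := by
        by_cases h0 : f' = 0
        · rw [h0, map_zero]
          exact W.zero_mem
        · exact ih _ (hd ▸ degree_cancel_lt τ hgf h0) f' rfl hf'J
      rw [hσ] at hW
      refine (W.smul_mem_iff ?_).1 hW
      rw [map_ne_zero]
      exact MonomialOrder.leadingCoeff_ne_zero_iff.2 hg0
    · obtain ⟨t, htle, ht⟩ := exists_minimal_le_of_wellFoundedLT
        (fun s => ∃ f ∈ G \ (rename (Sum.inr : A → X ⊕ A) ''
          (eliminate J : Set (MvPolynomial A K))), f ≠ 0 ∧ lppX τ f = s)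
        (lppX τ g) ⟨g, ⟨hgG, hgg⟩, hg0, rfl⟩
      have hs : lppX τ f ∈ S := ⟨t, ht, htle.trans (lppX_le_of_degree_le hτ hf0 hg0 hgf)⟩
      obtain ⟨hGe, -, hle, h0⟩ := he _ hs
      -- The divisor g need not have a leading coefficient surviving at P, so g' is used instead. It
      -- cancels the whole `LC_X(f)`, after f is multiplied by `LC_X(g')`, which is invertible at P.
      set g' := e (lppX τ f) with hg'
      set f' := rename Sum.inr (lcX τ g') * f -
        rename Sum.inr (lcX τ f) * rename Sum.inl (monomial (lppX τ f - lppX τ g') 1) * g' with hf'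
      have hf'J : f' ∈ J := J.sub_mem (J.mul_mem_left _ hf) (J.mul_mem_left _ (hGJ hGe))
      have hF : sumAlgEquiv K X A f' = C (lcX τ g') * sumAlgEquiv K X A f -
          monomial (lppX τ f - lppX τ g') (lcX τ f) * sumAlgEquiv K X A g' := by
        rw [hf', map_sub, map_mul, map_mul, map_mul, sumAlgEquiv_rename_inr,
          sumAlgEquiv_rename_inr, sumAlgEquiv_rename_inl_monomial, C_mul_monomial, mul_one]
      have hσ : specialize X P f' = aeval P (lcX τ g') • specialize X P f -
          aeval P (lcX τ f) • b (lppX τ f) := by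
        rw [hf', map_sub, map_mul, map_mul, map_mul, specialize_rename_inr, specialize_rename_inr,
          specialize_rename_inl_monomial, MvPolynomial.C_mul', mul_assoc, MvPolynomial.C_mul']
      have hW : specialize X P f' ∈ W := by
        by_cases hf'0 : f' = 0
        · rw [hf'0, map_zero]
          exact W.zero_mem
        · refine ih _ (hd ▸ degree_lt_of_lppX_lt hτ hf0 hf'0 ?_) f' rfl hf'J
          have := sumAlgEquiv_ne_zero hf'0
          rw [lppX, hF]
          rw [hF] at this
          exact degree_cancel_lt (restrictX τ) hle this
      rw [hσ] at hW
      have hb' : b (lppX τ f) ∈ W := Submodule.subset_span ⟨_, hs, rfl⟩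
      have := W.add_mem hW (W.smul_mem (aeval P (lcX τ f)) hb')
      rw [sub_add_cancel] at this
      exact (W.smul_mem_iff h0).1 this
  -- W is only a K̄-subspace by construction, whereas σ_P(J) is generated over K̄[X]; hence the
  -- statement is proved with an arbitrary multiplier q. For generators, monomials in X can be moved
  -- inside σ_P.
  have hJW : ∀ h ∈ J.map (specialize X P), ∀ q, q * h ∈ W := by
    intro h hh
    induction hh using Submodule.span_induction with
    | zero => simp
    | add _ _ _ _ h1 h2 => exact fun q => by rw [mul_add]; exact W.add_mem (h1 q) (h2 q)
    | smul a x _ h1 => exact fun q => by rw [smul_eq_mul, ← mul_assoc]; exact h1 _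
    | mem x hx =>
      obtain ⟨f, hf, rfl⟩ := hx
      intro q
      induction q using MvPolynomial.induction_on' with
      | add p q hp hq => rw [add_mul]; exact W.add_mem hp hq
      | monomial s c =>
        have := W.smul_mem c (key _ (J.mul_mem_left (rename Sum.inl (monomial s 1)) hf))
        rwa [map_mul, specialize_rename_inl_monomial, ← smul_mul_assoc, smul_monomial,
          smul_eq_mul, mul_one] at this
  refine ⟨(hGfin.subset fun g hg => hg.1).image _, ?_, ?_⟩
  · rintro _ ⟨g, hg, rfl⟩
    exact Ideal.mem_map_of_mem _ (hGJ hg.1)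
  · intro h hh h0
    have hs := degree_mem_of_mem_span (restrictX τ) hb (by simpa using hJW h hh 1) h0
    obtain ⟨h1, h2, h3, h4⟩ := he _ hs
    obtain ⟨h5, h6⟩ := degree_specialize τ h4
    exact ⟨_, ⟨_, ⟨h1, h2⟩, rfl⟩, h5, h6.trans_le h3⟩

/-! ### Termination -/

theorem exists_le_of_mem_appendMinimal {T N : Set (Ideal (MvPolynomial A K))}
    {𝔟 : Ideal (MvPolynomial A K)} (h : 𝔟 ∈ N) : ∃ 𝔷 ∈ appendMinimal T N, 𝔷 ≤ 𝔟 := by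
  by_cases h' : ∀ 𝔷 ∈ T, ¬ 𝔷 ≤ 𝔟
  · exact ⟨𝔟, Or.inr ⟨h, h'⟩, le_rfl⟩
  · push Not at h'
    obtain ⟨𝔷, hz, hle⟩ := h'
    exact ⟨𝔷, Or.inl hz, hle⟩

/-- One hydra move: the head 𝔞 is cut off and finitely many strictly larger ideals grow, larger
ideals being the smaller ones for the relation `>`. -/
theorem cutExpand_appendMinimal {T N : Set (Ideal (MvPolynomial A K))}
    {𝔞 : Ideal (MvPolynomial A K)} (h𝔞 : 𝔞 ∈ T) (hN : ∀ 𝔟 ∈ N, 𝔞 < 𝔟) (hT : T.Finite)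
    (hT' : (appendMinimal (T \ {𝔞}) N).Finite) :
    Relation.CutExpand (· > ·) hT'.toFinset.val hT.toFinset.val := by
  classical
  have hNfin : {𝔟 ∈ N | ∀ 𝔷 ∈ T \ {𝔞}, ¬ 𝔷 ≤ 𝔟}.Finite := hT'.subset Set.subset_union_right
  rw [Relation.cutExpand_iff]
  refine ⟨hNfin.toFinset.val, 𝔞, fun 𝔟 h𝔟 => hN 𝔟 ?_, by simpa using h𝔞, ?_⟩
  · simp only [Finset.mem_val, Set.Finite.mem_toFinset] at h𝔟
    exact h𝔟.1
  · have hdisj : Disjoint (hT.toFinset.erase 𝔞) hNfin.toFinset := by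
      rw [Finset.disjoint_left]
      intro 𝔟 h1 h2
      simp only [Finset.mem_erase, Set.Finite.mem_toFinset] at h1 h2
      exact h2.2 𝔟 ⟨h1.2, h1.1⟩ le_rfl
    rw [← Finset.erase_val, ← Finset.disjUnion_val _ _ hdisj, Finset.val_inj]
    ext 𝔟
    simp only [appendMinimal, Set.Finite.mem_toFinset, Finset.mem_disjUnion, Finset.mem_erase]
    simp [and_comm]

theorem finite_stepMB (τ : MonomialOrder (X ⊕ A)) {G : Set (MvPolynomial (X ⊕ A) K)}
    (hG : G.Finite) (𝔤 : Ideal (MvPolynomial A K)) : (stepMB τ G 𝔤).Finite := by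
  refine (hG.image (lppX τ)).subset fun t ht => ?_
  obtain ⟨f, hf, -, rfl⟩ := ht.1
  exact ⟨f, hf.1, rfl⟩

theorem finite_lcIdeal_sup (τ : MonomialOrder (X ⊕ A)) {G : Set (MvPolynomial (X ⊕ A) K)}
    (hG : G.Finite) (𝔤 : Ideal (MvPolynomial A K)) :
    {𝔟 | ∃ t ∈ stepMB τ G 𝔤, ¬ lcIdeal τ G t ≤ 𝔤 ∧ 𝔟 = lcIdeal τ G t ⊔ 𝔤}.Finite := by
  refine ((finite_stepMB τ hG 𝔤).image fun t => lcIdeal τ G t ⊔ 𝔤).subset ?_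
  rintro _ ⟨t, ht, -, rfl⟩
  exact ⟨t, ht, rfl⟩

section Algorithm

variable {τ : MonomialOrder (X ⊕ A)} {I : Ideal (MvPolynomial (X ⊕ A) K)}
  {gb : Ideal (MvPolynomial (X ⊕ A) K) → Set (MvPolynomial (X ⊕ A) K) → Prop}
  {S S' : State K A X}

/-- All that termination needs from an iteration. Always 𝔞 ≤ 𝔤; in the first case the inclusion is
strict because the zero sets differ, in the second 𝔠_t + 𝔤 exceeds 𝔤 because 𝔠_t is not contained in
𝔤. -/
theorem Step.exists_todo_eq (hgb : ∀ J G, gb J G → IsGroebnerBasis τ J G)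
    (h : Step τ I gb S S') : ∃ 𝔞 ∈ S.todo, ∃ N : Set (Ideal (MvPolynomial A K)),
      N.Finite ∧ (∀ 𝔟 ∈ N, 𝔞 < 𝔟) ∧ S'.todo = appendMinimal (S.todo \ {𝔞}) N := by
  cases h with
  | smaller 𝔞 𝔤 G h𝔞 hG h𝔤 hne =>
    refine ⟨𝔞, h𝔞, {𝔤}, Set.finite_singleton _, ?_, rfl⟩
    rintro _ rfl
    refine lt_of_le_of_ne (h𝔤 ▸ le_eliminate I 𝔞) ?_
    rintro rfl
    simp at hne
  | equal 𝔞 𝔤 G h𝔞 hG h𝔤 hne =>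
    refine ⟨𝔞, h𝔞, newVanishing τ G 𝔤, ?_, ?_, rfl⟩
    · exact (finite_lcIdeal_sup τ (hgb _ _ hG).1 𝔤).subset fun 𝔟 h𝔟 => h𝔟.1
    · rintro 𝔟 ⟨⟨t, -, ht, rfl⟩, -⟩
      refine lt_of_le_of_lt (h𝔤 ▸ le_eliminate I 𝔞) (lt_of_le_of_ne le_sup_right fun h => ht ?_)
      rw [h]
      exact le_sup_left

theorem Step.finite_todo (hgb : ∀ J G, gb J G → IsGroebnerBasis τ J G)
    (h : Step τ I gb S S') (hS : S.todo.Finite) : S'.todo.Finite := by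
  obtain ⟨𝔞, -, N, hN, -, heq⟩ := h.exists_todo_eq hgb
  rw [heq]
  exact hS.sdiff.union (hN.subset fun _ h => h.1)

theorem Step.finite_final (h : Step τ I gb S S') (hS : S.final.Finite) : S'.final.Finite := by
  cases h <;> exact hS.insert _

theorem Step.final_subset (h : Step τ I gb S S') : S.final ⊆ S'.final := by
  cases h <;> exact Set.subset_insert _ _

theorem terminates [Finite A] (hgb : ∀ J G, gb J G → IsGroebnerBasis τ J G) (hex : ∀ J, ∃ G, gb J G) :
    Terminates τ I gb := by
  constructor
  · rintro ⟨run, h0, hrun⟩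
    have hfin : ∀ n, (run n).todo.Finite := by
      intro n
      induction n with
      | zero => rw [h0]; exact Set.finite_singleton _
      | succ n ih => exact (hrun n).finite_todo hgb ih
    -- K[A] is noetherian, and well-foundedness passes from `>` to `Relation.CutExpand`.
    have : IsWellFounded (Ideal (MvPolynomial A K)) (· > ·) := ⟨wellFounded_gt⟩
    obtain ⟨n, hn⟩ := WellFounded.not_rel_apply_succ
      (r := Relation.CutExpand ((· > ·) : Ideal (MvPolynomial A K) → _ → Prop))
      fun n => (hfin n).toFinset.val
    obtain ⟨𝔞, h𝔞, N, -, hN, heq⟩ := (hrun n).exists_todo_eq hgb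
    have hfin' := hfin (n + 1)
    rw [heq] at hfin'
    have := cutExpand_appendMinimal h𝔞 hN (hfin n) hfin'
    simp only [← heq] at this
    exact hn this
  · rintro S - ⟨𝔞, h𝔞⟩
    obtain ⟨G, hG⟩ := hex (I ⊔ extend X 𝔞)
    by_cases hne : (zeros 𝔞 \ zeros (eliminate (I ⊔ extend X 𝔞))).Nonempty
    · exact ⟨_, .smaller S 𝔞 _ G h𝔞 hG rfl hne⟩
    · exact ⟨_, .equal S 𝔞 _ G h𝔞 hG rfl hne⟩

/-! ### Correctness and shape of the segments -/

theorem isGroebnerBasis_specialize_one {𝔞 : Ideal (MvPolynomial A K)}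
    {P : A → AlgebraicClosure K} (hP : P ∈ zeros 𝔞)
    (hP' : P ∉ zeros (eliminate (I ⊔ extend X 𝔞))) :
    IsGroebnerBasis (restrictX τ) (I.map (specialize X P)) (specialize X P '' {1}) := by
  rw [mem_zeros] at hP'
  push Not at hP'
  obtain ⟨p, hp, hp0⟩ := hP'
  -- An element p of J ∩ K[A] with p(P) ≠ 0 specializes to a unit, so σ_P(J) = σ_P(I) is the unit
  -- ideal.
  have h1 : (1 : MvPolynomial X (AlgebraicClosure K)) ∈ I.map (specialize X P) := by
    rw [← map_specialize_sup_extend I hP]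
    have := Ideal.mul_mem_left _ (C (aeval P p)⁻¹)
      (Ideal.mem_map_of_mem (specialize X P) (Ideal.mem_comap.1 hp))
    rwa [specialize_rename_inr, ← C_mul, inv_mul_cancel₀ hp0, C_1] at this
  rw [Set.image_singleton, map_one]
  exact ⟨Set.finite_singleton _, Set.singleton_subset_iff.2 h1, fun f _ _ =>
    ⟨1, rfl, one_ne_zero, by simp⟩⟩

theorem Reachable.isGroebnerSegment [Finite X] (hτ : IsEliminationOrder τ)
    (hgb : ∀ J G, gb J G → IsGroebnerBasis τ J G) (h : Reachable τ I gb S) :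
    ∀ p ∈ S.final, IsGroebnerSegment τ I p.1 p.2 := by
  induction h with
  | refl => exact fun p hp => hp.elim
  | tail _ hstep ih =>
    cases hstep with
    | smaller 𝔞 𝔤 G h𝔞 hG h𝔤 hne =>
      rintro p (rfl | hp)
      · subst h𝔤
        exact fun P hP => isGroebnerBasis_specialize_one hP.1 hP.2
      · exact ih p hp
    | equal 𝔞 𝔤 G h𝔞 hG h𝔤 hne =>
      rintro p (rfl | hp)
      · subst h𝔤
        rintro P ⟨hP, hPc⟩
        rw [← map_specialize_sup_extend I (zeros_anti (le_eliminate I 𝔞) hP)]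
        refine isGroebnerBasis_specialize hτ (hgb _ _ hG) hP fun t ht hPt => hPc ?_
        exact Set.mem_biUnion ht hPt
      · exact ih p hp

theorem Reachable.finite_final (h : Reachable τ I gb S) : S.final.Finite := by
  induction h with
  | refl => exact Set.finite_empty
  | tail _ hstep ih => exact hstep.finite_final ih

theorem Reachable.finite_snd (hgb : ∀ J G, gb J G → IsGroebnerBasis τ J G)
    (h : Reachable τ I gb S) : ∀ p ∈ S.final, p.2.Finite := by
  induction h with
  | refl => exact fun p hp => hp.elim
  | tail _ hstep ih =>
    cases hstep with
    | smaller =>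
      rintro p (rfl | hp)
      · exact Set.finite_singleton _
      · exact ih p hp
    | equal 𝔞 𝔤 G h𝔞 hG =>
      rintro p (rfl | hp)
      · exact (hgb _ _ hG).1.subset fun g hg => hg.1
      · exact ih p hp

theorem Reachable.exists_eq_zeros_diff (hgb : ∀ J G, gb J G → IsGroebnerBasis τ J G)
    (h : Reachable τ I gb S) :
    ∀ p ∈ S.final, ∃ 𝔞 𝔟 : Ideal (MvPolynomial A K), p.1 = zeros 𝔞 \ zeros 𝔟 := by
  induction h with
  | refl => exact fun p hp => hp.elim
  | tail _ hstep ih =>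
    cases hstep with
    | smaller =>
      rintro p (rfl | hp)
      · exact ⟨_, _, rfl⟩
      · exact ih p hp
    | equal 𝔞 𝔤 G h𝔞 hG =>
      rintro p (rfl | hp)
      · obtain ⟨𝔟, h𝔟⟩ := exists_zeros_eq_biUnion (finite_stepMB τ (hgb _ _ hG).1 𝔤) (lcIdeal τ G)
        exact ⟨𝔤, 𝔟, by rw [h𝔟]⟩
      · exact ih p hp

/-! ### Covering of the parameter space -/

theorem lppX_rename_inr (p : MvPolynomial A K) :
    lppX τ (rename (Sum.inr : A → X ⊕ A) p) = 0 := by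
  rw [lppX, sumAlgEquiv_rename_inr, MonomialOrder.degree_C]

theorem lcX_rename_inr (p : MvPolynomial A K) :
    lcX τ (rename (Sum.inr : A → X ⊕ A) p) = p := by
  rw [lcX, sumAlgEquiv_rename_inr, MonomialOrder.leadingCoeff_C]

theorem rename_lcX_ne_zero {f : MvPolynomial (X ⊕ A) K} (hf : f ≠ 0) :
    rename (Sum.inr : A → X ⊕ A) (lcX τ f) ≠ 0 :=
  (map_ne_zero_iff _ (rename_injective _ Sum.inr_injective)).2 (lcX_ne_zero τ hf)

/-- The leading power-product of `LC_X(f)` divides that of `f`. -/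
theorem degree_rename_lcX_le (hτ : IsEliminationOrder τ) {f : MvPolynomial (X ⊕ A) K}
    (hf : f ≠ 0) : τ.degree (rename (Sum.inr : A → X ⊕ A) (lcX τ f)) ≤ τ.degree f := by
  obtain ⟨u, hu, hfu⟩ := exists_degree_eq hτ hf
  obtain ⟨v, hv, hcv⟩ := exists_degree_eq hτ (rename_lcX_ne_zero (τ := τ) hf)
  have hu' : u.mapDomain Sum.inr ∈ (rename (Sum.inr : A → X ⊕ A) (lcX τ f)).support := by
    rw [mem_support_iff, coeff_rename_mapDomain _ Sum.inr_injective]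
    exact mem_support_iff.1 hu
  rw [lcX_rename_inr] at hv
  have hv' : (lppX τ f).mapDomain Sum.inl + v.mapDomain Sum.inr ∈ f.support := by
    rw [mem_support_iff, ← coeff_lcX]
    exact mem_support_iff.1 hv
  -- Here u is the A-part of the leading power-product of f and v is the leading power-product of
  -- `LC_X(f)`. Each occurs in the support of the other polynomial, so the two comparisons force u =
  -- v.
  have h1 := τ.le_degree hu'
  have h2 := τ.le_degree hv'
  rw [lppX_rename_inr, Finsupp.mapDomain_zero, zero_add] at hcv
  rw [hcv] at h1
  rw [hfu, map_add, map_add, add_le_add_iff_left] at h2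
  rw [hcv, hfu, τ.toSyn.injective (le_antisymm h2 h1)]
  exact le_add_self

/-- For a minimal Gröbner basis none of the ideals `𝔠_t` is contained in `𝔤`. -/
theorem not_lcIdeal_le_eliminate (hτ : IsEliminationOrder τ)
    {J : Ideal (MvPolynomial (X ⊕ A) K)} {G : Set (MvPolynomial (X ⊕ A) K)}
    (hG : IsMinimalGroebnerBasis τ J G) {t : X →₀ ℕ} (ht : t ∈ stepMB τ G (eliminate J)) :
    ¬ lcIdeal τ G t ≤ eliminate J := by
  intro hle
  obtain ⟨g, ⟨hgG, hg⟩, hg0, rfl⟩ := ht.1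
  have hc0 := rename_lcX_ne_zero (τ := τ) hg0
  have hcJ : rename (Sum.inr : A → X ⊕ A) (lcX τ g) ∈ J :=
    Ideal.mem_comap.1 (hle (Ideal.subset_span ⟨g, ⟨hgG, rfl⟩, rfl⟩))
  -- If 𝔠_t ⊆ 𝔤, then `LC_X(g)` lies in J and its leading power-product divides that of g. By
  -- minimality its divisor in G is g itself, so `LPP_X(g)` = 1 and g ∈ 𝔤, a contradiction.
  obtain ⟨g', hg'G, hg'0, hdvd⟩ := hG.1.2.2 _ hcJ hc0
  obtain rfl : g' = g := by
    by_contra hne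
    exact hG.2.2 g hgG g' hg'G hne (hdvd.trans (degree_rename_lcX_le hτ hg0))
  have := lppX_le_of_degree_le hτ hc0 hg0 hdvd
  rw [lppX_rename_inr] at this
  exact lppX_ne_zero_of_notMem (hG.1.2.1 hgG) hg (le_antisymm this zero_le)

theorem Reachable.exists_mem (hτ : IsEliminationOrder τ)
    (h : Reachable τ I (IsMinimalGroebnerBasis τ) S) (P : A → AlgebraicClosure K) :
    (∃ p ∈ S.final, P ∈ p.1) ∨ ∃ 𝔟 ∈ S.todo, P ∈ zeros 𝔟 := by
  induction h with
  | refl => exact Or.inr ⟨⊥, rfl, by simp [zeros, zeroLocus_bot]⟩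
  | tail _ hstep ih =>
    obtain ⟨p, hp, hPp⟩ | ⟨𝔟, h𝔟, hP𝔟⟩ := ih
    · exact Or.inl ⟨p, hstep.final_subset hp, hPp⟩
    -- An ideal that is not appended contains a pending one, whose zero set is at least as large.
    have happ : ∀ {T N : Set (Ideal (MvPolynomial A K))} {𝔠 : Ideal (MvPolynomial A K)},
        𝔠 ∈ N → P ∈ zeros 𝔠 → ∃ 𝔟 ∈ appendMinimal T N, P ∈ zeros 𝔟 := fun h hP => by
      obtain ⟨𝔷, hz, hle⟩ := exists_le_of_mem_appendMinimal h
      exact ⟨𝔷, hz, zeros_anti hle hP⟩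
    cases hstep with
    | smaller 𝔞 𝔤 G h𝔞 hG h𝔤 hne =>
      by_cases hba : 𝔟 = 𝔞
      · subst hba
        by_cases hP : P ∈ zeros 𝔤
        · exact Or.inr (happ rfl hP)
        · exact Or.inl ⟨_, Or.inl rfl, hP𝔟, hP⟩
      · exact Or.inr ⟨𝔟, Or.inl ⟨h𝔟, hba⟩, hP𝔟⟩
    | equal 𝔞 𝔤 G h𝔞 hG h𝔤 hne =>
      by_cases hba : 𝔟 = 𝔞
      · subst hba
        have hP : P ∈ zeros 𝔤 := by
          by_contra hP
          exact hne ⟨P, hP𝔟, hP⟩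
        by_cases hPt : P ∈ ⋃ t ∈ stepMB τ G 𝔤, zeros (lcIdeal τ G t)
        · obtain ⟨t, ht, hPt⟩ := Set.mem_iUnion₂.1 hPt
          have hnle : ¬ lcIdeal τ G t ≤ 𝔤 := by
            subst h𝔤
            exact not_lcIdeal_le_eliminate hτ hG ht
          -- Discarding the non-minimal candidates loses no point: below each lies a minimal one,
          -- which has at least the same zeros.
          obtain ⟨𝔠, hle, h𝔠⟩ := (finite_lcIdeal_sup τ hG.1.1 𝔤).exists_le_minimal
            (a := lcIdeal τ G t ⊔ 𝔤) ⟨t, ht, hnle, rfl⟩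
          exact Or.inr (happ h𝔠 (zeros_anti hle (mem_zeros_sup.2 ⟨hPt, hP⟩)))
        · exact Or.inl ⟨_, Or.inl rfl, hP, hPt⟩
      · exact Or.inr ⟨𝔟, Or.inl ⟨h𝔟, hba⟩, hP𝔟⟩

end Algorithm

end CGS

theorem mainTheorem1 {K A X : Type*} [Field K] [Finite A] [Finite X]
    (τ : MonomialOrder (X ⊕ A)) (hτ : CGS.IsEliminationOrder τ)
    (I : Ideal (MvPolynomial (X ⊕ A) K)) :
    -- termination, with arbitrary and with minimal Gröbner bases
    CGS.Terminates τ I (CGS.IsGroebnerBasis τ) ∧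
    CGS.Terminates τ I (CGS.IsMinimalGroebnerBasis τ) ∧
    -- correctness of each segment
    (∀ 𝒢, CGS.IsOutput τ I (CGS.IsGroebnerBasis τ) 𝒢 →
      ∀ p ∈ 𝒢, ∀ P ∈ p.1,
        CGS.IsGroebnerBasis (CGS.restrictX τ) (I.map (CGS.specialize X P))
          (CGS.specialize X P '' p.2)) ∧
    -- covering, and the summary
    (∀ 𝒢, CGS.IsOutput τ I (CGS.IsMinimalGroebnerBasis τ) 𝒢 →
      (∀ P : A → AlgebraicClosure K, ∃ p ∈ 𝒢, P ∈ p.1) ∧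
      CGS.IsComprehensiveGroebnerSystem τ I 𝒢) := by
  have hmin : ∀ J G, CGS.IsMinimalGroebnerBasis (k := K) τ J G → CGS.IsGroebnerBasis τ J G :=
    fun _ _ h => h.1
  have hex := CGS.exists_isMinimalGroebnerBasis (k := K) τ
  refine ⟨CGS.terminates (fun _ _ h => h) fun J => (hex J).imp fun G => hmin J G,
    CGS.terminates hmin hex,
    fun 𝒢 h => CGS.Reachable.isGroebnerSegment hτ (fun _ _ h => h) h, fun 𝒢 h => ?_⟩
  have hcov : ∀ P : A → AlgebraicClosure K, ∃ p ∈ 𝒢, P ∈ p.1 := fun P =>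
    (CGS.Reachable.exists_mem hτ h P).resolve_right fun ⟨_, h, _⟩ => h
  refine ⟨hcov, CGS.Reachable.finite_final h, CGS.Reachable.exists_eq_zeros_diff hmin h, ?_,
    CGS.Reachable.finite_snd hmin h, CGS.Reachable.isGroebnerSegment hτ hmin h⟩
  refine Set.eq_univ_of_forall fun P => ?_
  obtain ⟨p, hp, hP⟩ := hcov P
  exact Set.mem_biUnion hp hP
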